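/- Let $(Z_i,\eta_i,\epsilon_i)_{i\ge 1}$ be iid random vectors in $\mathbb R^3$ such that $Z_i$ is independent of $\eta_i$ and $Z_i$ is independent of $\epsilon_i$, $\operatorname{Var}(Z_i)=1$, $E[Z_i^4]<\infty$, and $\eta_i,\epsilon_i$ have finite variances $\sigma_\eta^2,\sigma_\epsilon^2$ and covariance $\sigma_{\epsilon\eta}$. Put $m_4=E[(Z_i-E Z_i)^4]$. Let $\beta_0,\beta_1,\pi_0,\pi_1\in\mathbb R$ with $\pi_1\neq 0$, and $$Y_i=\beta_0+\beta_1 D_i+\epsilon_i,\qquad D_i=\pi_0+\pi_1 Z_i+\eta_i .$$ Let $\lambda_n$ be a real sequence with $\lambda_n=o(\sqrt n)$. With $\widehat{\operatorname{Cov}}[U,Z]=\frac1n\sum_{i=1}^n (U_i-\bar U)(Z_i-\bar Z)$, define the ridge estimator $$\hat\beta_{\mathrm{ridge}}=\frac{\sum_{i=1}^n (Y_i-\bar Y)(Z_i-\bar Z)}{\sum_{i=1}^n (D_i-\bar D)(Z_i-\bar Z)+\lambda_n}=\frac{\widehat{\operatorname{Cov}}[Y,Z]}{\widehat{\operatorname{Cov}}[D,Z]+\lambda_n/n}.$$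 (The value assigned to the quotient when its denominator vanishes is taken to be $0$.) Then, as $n\to\infty$, $$\sqrt n\,\bigl(\hat\beta_{\mathrm{ridge}}-\beta_1\bigr)\xrightarrow{d}\mathcal N\!\left(0,\frac{\sigma_\epsilon^2}{\pi_1^2}\right),$$ where a normal law with zero variance is the point mass at its mean. Moreover, let $$\Sigma=\begin{pmatrix}\beta_1^2\pi_1^2(m_4-1)+\beta_1^2\sigma_\eta^2+\sigma_\epsilon^2+2\beta_1\sigma_{\epsilon\eta} & \beta_1\pi_1^2(m_4-1)+\beta_1\sigma_\eta^2+\sigma_{\epsilon\eta}\\ \beta_1\pi_1^2(m_4-1)+\beta_1\sigma_\eta^2+\sigma_{\epsilon\eta} & \pi_1^2(m_4-1)+\sigma_\eta^2\end{pmatrix}.$$ If $Z_i$ is independent of the pair $(\eta_i,\epsilon_i)$, then $$\sqrt n\left(\begin{pmatrix}\widehat{\operatorname{Cov}}[Y,Z]\\ \widehat{\operatorname{Cov}}[D,Z]+\lambda_n/n\end{pmatrix}-\begin{pmatrix}\beta_1\pi_1\\ \pi_1\end{pmatrix}\right)\xrightarrow{d}\mathcal N(0,\Sigma).$$ Finally,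 the terms of $\Sigma$ involving $m_4$ cancel in the delta-method variance of the ratio: the function $h(x,y)=x/y$ is differentiable at $(\beta_1\pi_1,\pi_1)$, and $\nabla h(\beta_1\pi_1,\pi_1)^{T}\,\Sigma\,\nabla h(\beta_1\pi_1,\pi_1)=\sigma_\epsilon^2/\pi_1^2$. -/

import Mathlib

open MeasureTheory ProbabilityTheory Filter Topology Matrix
open scoped Gradient

namespace RidgeIV

/-- The sample mean `x̄` of the first `n` entries of a sequence. -/
noncomputable def sampleMean (x : ℕ → ℝ) (n : ℕ) : ℝ :=
  (∑ i ∈ Finset.range n, x i) / n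

/-- The centered cross-product sum `∑ᵢ (xᵢ - x̄) (yᵢ - ȳ)` over the first `n` observations. -/
noncomputable def crossSum (x y : ℕ → ℝ) (n : ℕ) : ℝ :=
  ∑ i ∈ Finset.range n, (x i - sampleMean x n) * (y i - sampleMean y n)

/-- The sample covariance `(1/n) ∑ᵢ (xᵢ - x̄) (yᵢ - ȳ)` of the first `n` observations. -/
noncomputable def sampleCov (x y : ℕ → ℝ) (n : ℕ) : ℝ :=
  crossSum x y n / n

/-- The ridge IV estimator with penalty sequence `pen`, from the outcomes `y`, the endogenous
regressors `d` and the instruments `z`, computed from the first `n` observations. -/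
noncomputable def ridgeEstimator (pen : ℕ → ℝ) (y d z : ℕ → ℝ) (n : ℕ) : ℝ :=
  crossSum y z n / (crossSum d z n + pen n)

/-- The ridge IV estimator as a ratio of (penalized) sample covariances. -/
theorem ridgeEstimator_eq (pen : ℕ → ℝ) (y d z : ℕ → ℝ) (n : ℕ) :
    ridgeEstimator pen y d z n = sampleCov y z n / (sampleCov d z n + pen n / n) := by
  rcases Nat.eq_zero_or_pos n with rfl | hn
  · simp [ridgeEstimator, sampleCov, crossSum]
  · have h : (n : ℝ) ≠ 0 := by positivity
    rw [ridgeEstimator, sampleCov, sampleCov, ← add_div, div_div_div_cancel_right₀ h]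

/-- The just-identified linear IV model `Yᵢ = β₀ + β₁ Dᵢ + εᵢ`, `Dᵢ = π₀ + π₁ Zᵢ + ηᵢ`
with iid data, exogenous and fully stochastic instruments of unit variance and finite fourth
moment, and errors of finite variance. The intercepts are arbitrary, so neither the
errors nor the instruments are required to have mean zero. -/
structure IsStochasticIVModel {Ω : Type*} [MeasurableSpace Ω] (μ : Measure Ω)
    (β₀ β₁ π₀ π₁ : ℝ) (Y D Z η ε : ℕ → Ω → ℝ) : Prop where
  /-- The structural equation. -/
  outcome : ∀ i ω, Y i ω = β₀ + β₁ * D i ω + ε i ω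
  /-- The first-stage equation. -/
  firstStage : ∀ i ω, D i ω = π₀ + π₁ * Z i ω + η i ω
  /-- The data points are independent. -/
  indep : iIndepFun (fun i ω => (Z i ω, η i ω, ε i ω)) μ
  /-- The data points are identically distributed. -/
  ident : ∀ i, IdentDistrib (fun ω => (Z i ω, η i ω, ε i ω))
    (fun ω => (Z 0 ω, η 0 ω, ε 0 ω)) μ μ
  /-- The instrument is independent of the first-stage error. -/
  exogenous_firstStage : ∀ i, IndepFun (Z i) (η i) μ
  /-- The instrument is independent of the structural error. -/
  exogenous_outcome : ∀ i, IndepFun (Z i) (ε i) μ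
  /-- The instrument has a finite fourth moment. -/
  memLp_instrument : ∀ i, MemLp (Z i) 4 μ
  /-- The instrument has unit variance. -/
  variance_instrument : ∀ i, Var[Z i; μ] = 1
  /-- The first-stage error has finite variance. -/
  memLp_firstStage : ∀ i, MemLp (η i) 2 μ
  /-- The structural error has finite variance. -/
  memLp_outcome : ∀ i, MemLp (ε i) 2 μ

/-- The asymptotic covariance matrix of the pair formed by the sample covariance of `Y` and `Z`
and the sample covariance of `D` and `Z`, in terms of the coefficients, the fourth central moment
`m₄` of the instrument, the error variances `vη`, `vε` and the error covariance `c`. -/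
noncomputable def asympCov (β₁ π₁ m₄ vη vε c : ℝ) : Matrix (Fin 2) (Fin 2) ℝ :=
  !![β₁ ^ 2 * π₁ ^ 2 * (m₄ - 1) + β₁ ^ 2 * vη + vε + 2 * β₁ * c,
      β₁ * π₁ ^ 2 * (m₄ - 1) + β₁ * vη + c;
     β₁ * π₁ ^ 2 * (m₄ - 1) + β₁ * vη + c,
      π₁ ^ 2 * (m₄ - 1) + vη]

/-- The ratio map `h (x, y) = x / y` on the plane. -/
noncomputable def ratio (p : EuclideanSpace ℝ (Fin 2)) : ℝ := p 0 / p 1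

end RidgeIV

namespace RidgeIV

/-! ### Sample covariances of real sequences -/

/-! The ridge limit follows from an exact identity, not from the delta method. Since Ĉov[Y,Z] = β₁
Ĉov[D,Z] + Ĉov[ε,Z], wherever the denominator is nonzero √n(β̂ − β₁) equals (√n Ĉov[ε,Z] − β₁ λₙ/√n)
/ (Ĉov[D,Z] + λₙ/n) (`ridgeEstimator_sub_eq`). The penalty terms vanish because λₙ = o(√n), the
denominator tends to π₁ almost surely, and Slutsky leaves the limit of √n Ĉov[ε,Z] divided by π₁.
Hence only the marginal independences are needed here.

Every distributional limit comes from one CLT for √n(Ĉov[U,Z] − b) with U = a + bZ + ξ and ξ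
independent of Z (`IsStochasticIVModel.tendstoInDistribution_sampleCov`). Replacing sample means by
true means costs √n times a product of centered means, which is O(n^(-1/2)) in L¹. What remains is
an iid sum with variance b²(m₄ − 1) + Var ξ. The case U = ε has b = 0, so m₄ never enters.

For the pair, Cramér–Wold reduces to t₀Y + t₁D, which has the same form with ξ = (t₀β₁ + t₁)η + t₀ε;
independence of ξ and Z is where joint independence enters. The gradient of x/y is a direction with
t₀β₁ + t₁ = 0, so only t₀²σ_ε² survives in the quadratic form of Σ. -/

theorem sampleMean_sub_const (x : ℕ → ℝ) (a : ℝ) {n : ℕ} (hn : n ≠ 0) :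
    sampleMean (fun i => x i - a) n = sampleMean x n - a := by
  have h : (n : ℝ) ≠ 0 := by exact_mod_cast hn
  simp only [sampleMean, Finset.sum_sub_distrib, Finset.sum_const, Finset.card_range, nsmul_eq_mul]
  field_simp

theorem sampleMean_linear (c a b : ℝ) (x y : ℕ → ℝ) {n : ℕ} (hn : n ≠ 0) :
    sampleMean (fun i => c + a * x i + b * y i) n
      = c + a * sampleMean x n + b * sampleMean y n := by
  have h : (n : ℝ) ≠ 0 := by exact_mod_cast hn
  simp only [sampleMean, Finset.sum_add_distrib, Finset.sum_const, Finset.card_range,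
    nsmul_eq_mul, ← Finset.mul_sum]
  field_simp

theorem crossSum_eq_sub (x y : ℕ → ℝ) (n : ℕ) :
    crossSum x y n = ∑ i ∈ Finset.range n, x i * y i - n * (sampleMean x n * sampleMean y n) := by
  rcases eq_or_ne n 0 with rfl | hn
  · simp [crossSum]
  have h : (n : ℝ) ≠ 0 := by exact_mod_cast hn
  simp only [crossSum, sub_mul, mul_sub, Finset.sum_sub_distrib, ← Finset.mul_sum,
    ← Finset.sum_mul, Finset.sum_const, Finset.card_range, nsmul_eq_mul, sampleMean]
  field_simp
  ring

theorem crossSum_sub_const (x y : ℕ → ℝ) (a b : ℝ) (n : ℕ) :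
    crossSum (fun i => x i - a) (fun i => y i - b) n = crossSum x y n := by
  rcases eq_or_ne n 0 with rfl | hn
  · simp [crossSum]
  · simp [crossSum, sampleMean_sub_const _ _ hn]

theorem crossSum_linear (c a b : ℝ) (x y z : ℕ → ℝ) (n : ℕ) :
    crossSum (fun i => c + a * x i + b * y i) z n = a * crossSum x z n + b * crossSum y z n := by
  rcases eq_or_ne n 0 with rfl | hn
  · simp [crossSum]
  · simp only [crossSum, sampleMean_linear _ _ _ _ _ hn, Finset.mul_sum, ← Finset.sum_add_distrib]
    exact Finset.sum_congr rfl fun i _ => by ring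

theorem sampleCov_linear (c a b : ℝ) (x y z : ℕ → ℝ) (n : ℕ) :
    sampleCov (fun i => c + a * x i + b * y i) z n
      = a * sampleCov x z n + b * sampleCov y z n := by
  simp only [sampleCov, crossSum_linear]
  ring

theorem sampleCov_eq_sub (x y : ℕ → ℝ) (n : ℕ) :
    sampleCov x y n
      = sampleMean (fun i => x i * y i) n - sampleMean x n * sampleMean y n := by
  rcases eq_or_ne n 0 with rfl | hn
  · simp [sampleCov, crossSum, sampleMean]
  have h : (n : ℝ) ≠ 0 := by exact_mod_cast hn
  rw [sampleCov, crossSum_eq_sub, sub_div, mul_div_cancel_left₀ _ h, ← sampleMean]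

/-- Cross sums are translation invariant, so any centering is allowed. With `a`, `b` the true means
and `c` the covariance, the first term is the normalized sum of the classical CLT and the second is
the remainder to be shown negligible. -/
theorem sqrt_mul_sampleCov_sub (x y : ℕ → ℝ) (a b c : ℝ) (n : ℕ) :
    √(n : ℝ) * (sampleCov x y n - c)
      = (√(n : ℝ))⁻¹ * (∑ i ∈ Finset.range n, (x i - a) * (y i - b) - n * c)
        - √(n : ℝ) * (sampleMean (fun i => x i - a) n * sampleMean (fun i => y i - b) n) := by
  rcases eq_or_ne n 0 with rfl | hn
  · simp
  have h : (n : ℝ) ≠ 0 := by exact_mod_cast hn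
  have hs : √(n : ℝ) ≠ 0 := by positivity
  have hsq : √(n : ℝ) ^ 2 = n := Real.sq_sqrt (by positivity)
  rw [sampleCov, ← crossSum_sub_const x y a b, crossSum_eq_sub]
  generalize sampleMean (fun i => x i - a) n = u
  generalize sampleMean (fun i => y i - b) n = v
  generalize ∑ i ∈ Finset.range n, (x i - a) * (y i - b) = S
  generalize √(n : ℝ) = s at *
  rw [← hsq]
  field_simp
  ring

/-! ### Limit theorems for sample covariances -/

section Limit

variable {Ω Ω' : Type*} {mΩ : MeasurableSpace Ω} {mΩ' : MeasurableSpace Ω'}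
  {μ : Measure Ω} {P' : Measure Ω'} [IsProbabilityMeasure P']

theorem memLp_sampleMean {U : ℕ → Ω → ℝ} {p : ENNReal} (hU : ∀ i, MemLp (U i) p μ) (n : ℕ) :
    MemLp (fun ω => sampleMean (fun i => U i ω) n) p μ := by
  simp only [sampleMean, div_eq_mul_inv]
  exact (memLp_finsetSum _ fun i _ => hU i).mul_const _

theorem aemeasurable_sampleMean {U : ℕ → Ω → ℝ} (hU : ∀ i, AEMeasurable (U i) μ) (n : ℕ) :
    AEMeasurable (fun ω => sampleMean (fun i => U i ω) n) μ :=
  (Finset.aemeasurable_fun_sum _ fun i _ => hU i).div_const _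

theorem aemeasurable_sampleCov {U V : ℕ → Ω → ℝ} (hU : ∀ i, AEMeasurable (U i) μ)
    (hV : ∀ i, AEMeasurable (V i) μ) (n : ℕ) :
    AEMeasurable (fun ω => sampleCov (fun i => U i ω) (fun i => V i ω) n) μ := by
  simp only [sampleCov_eq_sub]
  exact (aemeasurable_sampleMean (fun i => (hU i).mul (hV i)) n).sub
    ((aemeasurable_sampleMean hU n).mul (aemeasurable_sampleMean hV n))

theorem ae_tendsto_sampleMean {U : ℕ → Ω → ℝ} (hindep : iIndepFun U μ)
    (hident : ∀ i, IdentDistrib (U i) (U 0) μ μ) (hU : Integrable (U 0) μ) :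
    ∀ᵐ ω ∂μ, Tendsto (fun n => sampleMean (fun i => U i ω) n) atTop (𝓝 μ[U 0]) :=
  strong_law_ae_real U hU (fun _ _ hij => hindep.indepFun hij) hident

variable [IsProbabilityMeasure μ]

theorem integral_sampleMean_sq_of_centered {U : ℕ → Ω → ℝ} (hindep : iIndepFun U μ)
    (hident : ∀ i, IdentDistrib (U i) (U 0) μ μ) (hU : MemLp (U 0) 2 μ) (h0 : μ[U 0] = 0)
    (n : ℕ) : ∫ ω, sampleMean (fun i => U i ω) n ^ 2 ∂μ = Var[U 0; μ] / n := by
  have hL (i : ℕ) : MemLp (U i) 2 μ := (hident i).memLp_iff.2 hU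
  have hsum : MemLp (∑ i ∈ Finset.range n, U i) 2 μ := memLp_finsetSum' _ fun i _ => hL i
  have hmean : ∫ ω, (∑ i ∈ Finset.range n, U i) ω ∂μ = 0 := by
    simp only [Finset.sum_apply]
    rw [integral_finsetSum _ fun i _ => (hL i).integrable (by norm_num)]
    exact Finset.sum_eq_zero fun i _ => by rw [(hident i).integral_eq, h0]
  have hvar : ∫ ω, (∑ i ∈ Finset.range n, U i ω) ^ 2 ∂μ = n * Var[U 0; μ] := by
    have h := IndepFun.variance_sum (s := Finset.range n) (fun i _ => hL i)
      fun i _ j _ hij => hindep.indepFun hij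
    rw [variance_eq_sub hsum, hmean, Finset.sum_congr rfl fun i _ => (hident i).variance_eq] at h
    simpa using h
  simp only [sampleMean, div_pow]
  rw [integral_div, hvar]
  rcases eq_or_ne n 0 with rfl | hn
  · simp
  have : (n : ℝ) ≠ 0 := by exact_mod_cast hn
  field_simp

/-- The product of two centered sample means is negligible at the scale `√n`. -/
theorem tendstoInMeasure_sqrt_mul_sampleMean_mul_sampleMean {U V : ℕ → Ω → ℝ}
    (hUindep : iIndepFun U μ) (hVindep : iIndepFun V μ)
    (hUident : ∀ i, IdentDistrib (U i) (U 0) μ μ) (hVident : ∀ i, IdentDistrib (V i) (V 0) μ μ)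
    (hU : MemLp (U 0) 2 μ) (hV : MemLp (V 0) 2 μ) (hU0 : μ[U 0] = 0) (hV0 : μ[V 0] = 0) :
    TendstoInMeasure μ (fun (n : ℕ) ω => √(n : ℝ) *
      (sampleMean (fun i => U i ω) n * sampleMean (fun i => V i ω) n)) atTop 0 := by
  have hLU := memLp_sampleMean (fun i => (hUident i).memLp_iff.2 hU)
  have hLV := memLp_sampleMean (fun i => (hVident i).memLp_iff.2 hV)
  have hint (n : ℕ) : Integrable (fun ω => √(n : ℝ) *
      (sampleMean (fun i => U i ω) n * sampleMean (fun i => V i ω) n)) μ :=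
    ((hLU n).integrable_mul (hLV n)).const_mul _
  refine tendstoInMeasure_of_tendsto_eLpNorm one_ne_zero
    (fun n => (hint n).aestronglyMeasurable) aestronglyMeasurable_zero ?_
  -- L¹ bound: |uv| ≤ u² + v², and each squared mean has expectation variance / n, so the factor √n
  -- leaves n^(-1/2).
  have hbound (n : ℕ) : ∫ ω, ‖√(n : ℝ) *
      (sampleMean (fun i => U i ω) n * sampleMean (fun i => V i ω) n)‖ ∂μ
        ≤ (Var[U 0; μ] + Var[V 0; μ]) * (√(n : ℝ))⁻¹ := by
    calc _ ≤ ∫ ω, √(n : ℝ) * (sampleMean (fun i => U i ω) n ^ 2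
              + sampleMean (fun i => V i ω) n ^ 2) ∂μ := by
          refine integral_mono (hint n).norm
            (((hLU n).integrable_sq.add (hLV n).integrable_sq).const_mul _) fun ω => ?_
          simp only [norm_mul, Real.norm_eq_abs, abs_of_nonneg (Real.sqrt_nonneg _)]
          gcongr
          rw [← abs_mul, abs_le]
          constructor <;> nlinarith [sq_nonneg (sampleMean (fun i => U i ω) n
            + sampleMean (fun i => V i ω) n), sq_nonneg (sampleMean (fun i => U i ω) n
            - sampleMean (fun i => V i ω) n), sq_nonneg (sampleMean (fun i => U i ω) n),
            sq_nonneg (sampleMean (fun i => V i ω) n)]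
      _ = (Var[U 0; μ] + Var[V 0; μ]) * (√(n : ℝ) / n) := by
          rw [integral_const_mul, integral_add (hLU n).integrable_sq (hLV n).integrable_sq,
            integral_sampleMean_sq_of_centered hUindep hUident hU hU0,
            integral_sampleMean_sq_of_centered hVindep hVident hV hV0]
          ring
      _ = _ := by rw [Real.sqrt_div_self]
  have hlim : Tendsto (fun n : ℕ => (Var[U 0; μ] + Var[V 0; μ]) * (√(n : ℝ))⁻¹) atTop (𝓝 0) := by
    simpa using ((tendsto_inv_atTop_zero.comp (Real.tendsto_sqrt_atTop.comp
      tendsto_natCast_atTop_atTop)).const_mul (Var[U 0; μ] + Var[V 0; μ]))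
  have hnorm := squeeze_zero (fun n => integral_nonneg fun ω => norm_nonneg _) hbound hlim
  have h := ENNReal.tendsto_ofReal hnorm
  rw [ENNReal.ofReal_zero] at h
  refine h.congr fun n => ?_
  rw [sub_zero, eLpNorm_one_eq_lintegral_enorm, ofReal_integral_norm_eq_lintegral_enorm (hint n)]

/-- **Central limit theorem** for the sample covariance of an iid sequence of pairs. -/
theorem tendstoInDistribution_sqrt_mul_sampleCov {U V : ℕ → Ω → ℝ} {G : Ω' → ℝ}
    (hindep : iIndepFun (fun i ω => (U i ω, V i ω)) μ)
    (hident : ∀ i, IdentDistrib (fun ω => (U i ω, V i ω)) (fun ω => (U 0 ω, V 0 ω)) μ μ)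
    (hU : MemLp (U 0) 2 μ) (hV : MemLp (V 0) 2 μ)
    (hUV : MemLp (fun ω => (U 0 ω - μ[U 0]) * (V 0 ω - μ[V 0])) 2 μ)
    (hG : HasLaw G (gaussianReal 0
      Var[fun ω => (U 0 ω - μ[U 0]) * (V 0 ω - μ[V 0]); μ].toNNReal) P') :
    TendstoInDistribution (fun (n : ℕ) ω =>
      √(n : ℝ) * (sampleCov (fun i => U i ω) (fun i => V i ω) n - cov[U 0, V 0; μ]))
      atTop G (fun _ => μ) P' := by
  have hUident (i : ℕ) : IdentDistrib (U i) (U 0) μ μ := (hident i).comp measurable_fst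
  have hVident (i : ℕ) : IdentDistrib (V i) (V 0) μ μ := (hident i).comp measurable_snd
  obtain ⟨a, ha⟩ : ∃ a : ℝ, μ[U 0] = a := ⟨_, rfl⟩
  obtain ⟨b, hb⟩ : ∃ b : ℝ, μ[V 0] = b := ⟨_, rfl⟩
  rw [ha, hb] at hG hUV
  obtain ⟨X, hX⟩ : ∃ X : ℕ → Ω → ℝ, X = fun i ω => (U i ω - a) * (V i ω - b) := ⟨_, rfl⟩
  have hX0 : X 0 = fun ω => (U 0 ω - a) * (V 0 ω - b) := by rw [hX]
  have hcov : cov[U 0, V 0; μ] = μ[X 0] := by rw [hX0, covariance, ha, hb]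
  have hXindep : iIndepFun X μ := by
    rw [hX]
    exact hindep.comp (fun _ (p : ℝ × ℝ) => (p.1 - a) * (p.2 - b)) fun _ => by fun_prop
  have hXident (i : ℕ) : IdentDistrib (X i) (X 0) μ μ := by
    rw [hX]
    exact (hident i).comp (u := fun p : ℝ × ℝ => (p.1 - a) * (p.2 - b)) (by fun_prop)
  rw [← hX0] at hG hUV
  have hclt := tendstoInDistribution_inv_sqrt_mul_sum_sub hG hUV hXindep hXident
  have hrem := tendstoInMeasure_sqrt_mul_sampleMean_mul_sampleMean (μ := μ)
    (U := fun i ω => U i ω - a) (V := fun i ω => V i ω - b)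
    (hindep.comp (fun _ (p : ℝ × ℝ) => p.1 - a) fun _ => by fun_prop)
    (hindep.comp (fun _ (p : ℝ × ℝ) => p.2 - b) fun _ => by fun_prop)
    (fun i => (hUident i).comp (u := fun x : ℝ => x - a) (by fun_prop))
    (fun i => (hVident i).comp (u := fun x : ℝ => x - b) (by fun_prop))
    (hU.sub (memLp_const _)) (hV.sub (memLp_const _))
    (by rw [integral_sub (hU.integrable (by norm_num)) (integrable_const _)]; simp [ha])
    (by rw [integral_sub (hV.integrable (by norm_num)) (integrable_const _)]; simp [hb])
  refine tendstoInDistribution_of_tendstoInMeasure_sub _ _ hclt ?_ fun n =>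
    ((aemeasurable_sampleCov (fun i => (hUident i).aemeasurable_fst)
      (fun i => (hVident i).aemeasurable_fst) n).sub_const _).const_mul _
  -- The sample covariance differs from the CLT sum by minus the remainder, so the two agree only in
  -- norm.
  rw [tendstoInMeasure_iff_norm] at hrem ⊢
  intro r hr
  refine (hrem r hr).congr fun n => ?_
  congr 1
  ext ω
  simp only [Pi.sub_apply, Pi.zero_apply, sub_zero, Set.mem_ofPred_eq]
  rw [sqrt_mul_sampleCov_sub _ _ a b cov[U 0, V 0; μ] n]
  simp only [hcov, hX, sub_sub_cancel_left, norm_neg]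

/-- Strong consistency of the sample covariance. -/
theorem ae_tendsto_sampleCov {U V : ℕ → Ω → ℝ}
    (hindep : iIndepFun (fun i ω => (U i ω, V i ω)) μ)
    (hident : ∀ i, IdentDistrib (fun ω => (U i ω, V i ω)) (fun ω => (U 0 ω, V 0 ω)) μ μ)
    (hU : MemLp (U 0) 2 μ) (hV : MemLp (V 0) 2 μ) :
    ∀ᵐ ω ∂μ, Tendsto (fun n => sampleCov (fun i => U i ω) (fun i => V i ω) n) atTop
      (𝓝 cov[U 0, V 0; μ]) := by
  filter_upwards [
    ae_tendsto_sampleMean (U := fun i ω => U i ω * V i ω)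
      (hindep.comp (fun _ (p : ℝ × ℝ) => p.1 * p.2) fun _ => by fun_prop)
      (fun i => (hident i).comp (u := fun p : ℝ × ℝ => p.1 * p.2) (by fun_prop)) (hU.integrable_mul hV),
    ae_tendsto_sampleMean (U := U) (hindep.comp (fun _ (p : ℝ × ℝ) => p.1) fun _ => by fun_prop)
      (fun i => (hident i).comp measurable_fst) (hU.integrable (by norm_num)),
    ae_tendsto_sampleMean (U := V) (hindep.comp (fun _ (p : ℝ × ℝ) => p.2) fun _ => by fun_prop)
      (fun i => (hident i).comp measurable_snd) (hV.integrable (by norm_num))] with ω h₁ h₂ h₃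
  simp only [sampleCov_eq_sub]
  rw [covariance_eq_sub hU hV]
  exact h₁.sub (h₂.mul h₃)

/-- The **Cramér–Wold device** for a centered Gaussian limit. -/
theorem tendstoInDistribution_multivariateGaussian {ι : Type*} [Fintype ι] [DecidableEq ι]
    {S : Matrix ι ι ℝ} (hS : S.PosSemidef) {X : ℕ → Ω → EuclideanSpace ℝ ι}
    (h : ∀ t : EuclideanSpace ℝ ι, TendstoInDistribution (fun n ω => inner ℝ (X n ω) t) atTop
      (id : ℝ → ℝ) (fun _ => μ) (gaussianReal 0 (t.ofLp ⬝ᵥ S *ᵥ t.ofLp).toNNReal))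
    (hX : ∀ n, AEMeasurable (X n) μ) :
    TendstoInDistribution X atTop (id : EuclideanSpace ℝ ι → EuclideanSpace ℝ ι) (fun _ => μ)
      (multivariateGaussian 0 S) where
  forall_aemeasurable := hX
  tendsto := by
    refine ProbabilityMeasure.tendsto_iff_tendsto_charFun.2 fun t => ?_
    -- The characteristic function of `X n` at `t` is that of the projection ⟨`X n`, `t`⟩ at 1.
    have ht := ProbabilityMeasure.tendsto_iff_tendsto_charFun.1 (h t).tendsto 1
    have hpos : 0 ≤ t.ofLp ⬝ᵥ S *ᵥ t.ofLp := by simpa using hS.dotProduct_mulVec_nonneg t.ofLp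
    simp only [ProbabilityMeasure.coe_mk, Measure.map_id, charFun_gaussianReal,
      charFun_multivariateGaussian hS] at ht ⊢
    convert! ht using 2 with n
    · rw [charFun_apply, charFun_apply, integral_map (hX n) (by fun_prop),
        integral_map ((h t).forall_aemeasurable n) (by fun_prop)]
      simp
    · simp [Real.coe_toNNReal _ hpos]

end Limit

/-! ### Moments of the centered cross product -/

section Moments

variable {Ω : Type*} {mΩ : MeasurableSpace Ω} {μ : Measure Ω}

/-- Independence factorizes E[X²Y²], so second moments suffice where Hölder would ask for fourth
ones. This is why the errors need only finite variance. -/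
theorem memLp_two_mul_of_indepFun {X Y : Ω → ℝ} (h : IndepFun X Y μ) (hX : MemLp X 2 μ)
    (hY : MemLp Y 2 μ) : MemLp (fun ω => X ω * Y ω) 2 μ := by
  refine (memLp_two_iff_integrable_sq (hX.1.mul hY.1)).2 ?_
  have hsq : IndepFun (fun ω => X ω ^ 2) (fun ω => Y ω ^ 2) μ :=
    h.comp (φ := fun x : ℝ => x ^ 2) (ψ := fun x : ℝ => x ^ 2) (by fun_prop) (by fun_prop)
  exact (hsq.integrable_mul hX.integrable_sq hY.integrable_sq).congr
    (ae_of_all _ fun ω => (mul_pow _ _ _).symm)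

theorem memLp_two_sq {X : Ω → ℝ} (hX : MemLp X 4 μ) : MemLp (fun ω => X ω ^ 2) 2 μ := by
  refine (memLp_two_iff_integrable_sq (hX.1.pow 2)).2 ?_
  have h := hX.integrable_norm_pow (p := 4) (by norm_num)
  refine h.congr (ae_of_all _ fun ω => ?_)
  change |X ω| ^ 4 = (X ω ^ 2) ^ 2
  rw [Even.pow_abs ⟨2, rfl⟩, ← pow_mul]

theorem indepFun_sub_const {X Y : Ω → ℝ} (h : IndepFun X Y μ) (a b : ℝ) :
    IndepFun (fun ω => X ω - a) (fun ω => Y ω - b) μ :=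
  h.comp (φ := fun x : ℝ => x - a) (ψ := fun x : ℝ => x - b) (by fun_prop) (by fun_prop)

variable [IsProbabilityMeasure μ]

theorem integral_sub_integral {X : Ω → ℝ} (hX : Integrable X μ) :
    ∫ ω, (X ω - μ[X]) ∂μ = 0 := by
  rw [integral_sub hX (integrable_const _)]
  simp

/-- For independent centered `X` and `Y` with `E X² = 1`, the variance of `b X² + Y X`. -/
theorem variance_sq_add_mul_of_indepFun {X Y : Ω → ℝ} (h : IndepFun X Y μ) (hX : MemLp X 4 μ)
    (hY : MemLp Y 2 μ) (hX0 : μ[X] = 0) (hY0 : μ[Y] = 0) (hX1 : ∫ ω, X ω ^ 2 ∂μ = 1) (b : ℝ) :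
    Var[fun ω => b * X ω ^ 2 + Y ω * X ω; μ]
      = b ^ 2 * (∫ ω, X ω ^ 4 ∂μ - 1) + ∫ ω, Y ω ^ 2 ∂μ := by
  have hX2 : MemLp X 2 μ := hX.mono_exponent (by norm_num)
  have hsq := memLp_two_sq hX
  have hYX : MemLp (fun ω => Y ω * X ω) 2 μ := memLp_two_mul_of_indepFun h.symm hY hX2
  have hYX0 : ∫ ω, Y ω * X ω ∂μ = 0 := by
    rw [h.symm.integral_fun_mul_eq_mul_integral hY.1 hX.1, hX0, mul_zero]
  -- The cross term is E[X³Y] = E[X³] E[Y] = 0.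
  have hcov : cov[fun ω => X ω ^ 2, fun ω => Y ω * X ω; μ] = 0 := by
    have hind : IndepFun (fun ω => X ω ^ 3) Y μ :=
      h.comp (φ := fun x : ℝ => x ^ 3) (by fun_prop) measurable_id
    have h3 : ∫ ω, X ω ^ 2 * (Y ω * X ω) ∂μ = 0 := by
      rw [← mul_zero (∫ ω, X ω ^ 3 ∂μ), ← hY0,
        ← hind.integral_fun_mul_eq_mul_integral (hX.1.pow 3) hY.1]
      exact integral_congr_ae (ae_of_all _ fun ω => by ring)
    rw [covariance_eq_sub hsq hYX, hYX0, mul_zero, sub_zero]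
    exact h3
  have hvarsq : Var[fun ω => X ω ^ 2; μ] = ∫ ω, X ω ^ 4 ∂μ - 1 := by
    rw [variance_eq_sub hsq, hX1]
    simp only [Pi.pow_apply, ← pow_mul]
    norm_num
  have hvarYX : Var[fun ω => Y ω * X ω; μ] = ∫ ω, Y ω ^ 2 ∂μ := by
    have hind : IndepFun (fun ω => Y ω ^ 2) (fun ω => X ω ^ 2) μ :=
      h.symm.comp (φ := fun x : ℝ => x ^ 2) (ψ := fun x : ℝ => x ^ 2) (by fun_prop) (by fun_prop)
    rw [variance_eq_sub hYX, hYX0]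
    simp only [Pi.pow_apply, mul_pow]
    rw [hind.integral_fun_mul_eq_mul_integral (hY.1.pow 2) (hX.1.pow 2), hX1]
    ring
  have hadd := variance_add (hsq.const_mul b) hYX
  rw [variance_const_mul, covariance_const_mul_left, hcov, hvarsq, hvarYX] at hadd
  refine Eq.trans ?_ (hadd.trans (by ring))
  rfl

/-! ### Linear functions of the instrument plus noise -/

section Regression

variable {U X Y : Ω → ℝ} {a b : ℝ}

theorem sub_integral_of_linear (hU : U = fun ω => a + b * X ω + Y ω) (hX : Integrable X μ)
    (hY : Integrable Y μ) (ω : Ω) :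
    U ω - μ[U] = b * (X ω - μ[X]) + (Y ω - μ[Y]) := by
  have : μ[U] = a + b * μ[X] + μ[Y] := by
    have h1 : ∫ ω, (a + b * X ω) ∂μ = a + b * μ[X] := by
      rw [integral_add (integrable_const a) (hX.const_mul b), integral_const_mul]
      simp
    rw [hU, ← h1]
    exact integral_add ((integrable_const a).add (hX.const_mul b)) hY
  rw [this, hU]
  ring

theorem covariance_of_linear (hU : U = fun ω => a + b * X ω + Y ω) (hX : MemLp X 2 μ)
    (hY : MemLp Y 2 μ) (hX1 : Var[X; μ] = 1) : cov[U, X; μ] = b + cov[Y, X; μ] := by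
  have hXi := hX.integrable one_le_two
  have hYi := hY.integrable one_le_two
  have hXc : MemLp (fun ω => X ω - μ[X]) 2 μ := hX.sub (memLp_const _)
  have hYc : MemLp (fun ω => Y ω - μ[Y]) 2 μ := hY.sub (memLp_const _)
  rw [variance_eq_integral hX.aemeasurable] at hX1
  simp only [covariance, sub_integral_of_linear hU hXi hYi]
  have hsplit : ∀ ω, (b * (X ω - μ[X]) + (Y ω - μ[Y])) * (X ω - μ[X])
      = b * (X ω - μ[X]) ^ 2 + (Y ω - μ[Y]) * (X ω - μ[X]) := fun ω => by ring
  simp only [hsplit]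
  refine (integral_add (hXc.integrable_sq.const_mul b) (hYc.integrable_mul hXc)).trans ?_
  rw [integral_const_mul, hX1, mul_one]
  rfl

theorem centered_mul_of_linear (hU : U = fun ω => a + b * X ω + Y ω) (hX : Integrable X μ)
    (hY : Integrable Y μ) :
    (fun ω => (U ω - μ[U]) * (X ω - μ[X]))
      = fun ω => b * (X ω - μ[X]) ^ 2 + (Y ω - μ[Y]) * (X ω - μ[X]) := by
  ext ω
  rw [sub_integral_of_linear hU hX hY]
  ring

theorem memLp_centered_mul_of_linear (hU : U = fun ω => a + b * X ω + Y ω) (h : IndepFun X Y μ)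
    (hX : MemLp X 4 μ) (hY : MemLp Y 2 μ) :
    MemLp (fun ω => (U ω - μ[U]) * (X ω - μ[X])) 2 μ := by
  have hX2 : MemLp X 2 μ := hX.mono_exponent (by norm_num)
  rw [centered_mul_of_linear hU (hX2.integrable one_le_two) (hY.integrable one_le_two)]
  have hXc : MemLp (fun ω => X ω - μ[X]) 4 μ := hX.sub (memLp_const _)
  exact ((memLp_two_sq hXc).const_mul b).add
    (memLp_two_mul_of_indepFun (indepFun_sub_const h.symm _ _) (hY.sub (memLp_const _))
      (hX2.sub (memLp_const _)))

/-- After centering, the product is b X² + Y X with X, Y centered and independent, which is the case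
computed in `variance_sq_add_mul_of_indepFun`. -/
theorem variance_centered_mul_of_linear (hU : U = fun ω => a + b * X ω + Y ω)
    (h : IndepFun X Y μ) (hX : MemLp X 4 μ) (hY : MemLp Y 2 μ) (hX1 : Var[X; μ] = 1) :
    Var[fun ω => (U ω - μ[U]) * (X ω - μ[X]); μ]
      = b ^ 2 * (centralMoment X 4 μ - 1) + Var[Y; μ] := by
  have hX2 : MemLp X 2 μ := hX.mono_exponent (by norm_num)
  have hXi := hX2.integrable one_le_two
  have hYi := hY.integrable one_le_two
  rw [variance_eq_integral hX.aemeasurable] at hX1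
  rw [centered_mul_of_linear hU hXi hYi, variance_sq_add_mul_of_indepFun
    (indepFun_sub_const h _ _) (hX.sub (memLp_const _)) (hY.sub (memLp_const _))
    (integral_sub_integral hXi) (integral_sub_integral hYi) hX1 b,
    variance_eq_integral hY.aemeasurable]
  rfl

end Regression

end Moments

/-! ### The instrumental variables model -/

/-- Grouping by t₀β₁ + t₁, the coefficient of η in t₀Y + t₁D, exhibits the form as a variance and
isolates what the gradient of the ratio annihilates. -/
theorem dotProduct_asympCov_mulVec (β₁ π₁ m₄ vη vε c : ℝ) (t : Fin 2 → ℝ) :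
    t ⬝ᵥ asympCov β₁ π₁ m₄ vη vε c *ᵥ t
      = ((t 0 * β₁ + t 1) * π₁) ^ 2 * (m₄ - 1)
        + ((t 0 * β₁ + t 1) ^ 2 * vη + 2 * ((t 0 * β₁ + t 1) * t 0 * c) + t 0 ^ 2 * vε) := by
  simp [asympCov, Matrix.mulVec, dotProduct, Fin.sum_univ_two]
  ring

theorem isHermitian_asympCov (β₁ π₁ m₄ vη vε c : ℝ) :
    (asympCov β₁ π₁ m₄ vη vε c).IsHermitian := by
  ext i j
  fin_cases i <;> fin_cases j <;> simp [asympCov]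

theorem hasGradientAt_ratio {p : EuclideanSpace ℝ (Fin 2)} (hp : p 1 ≠ 0) :
    HasGradientAt ratio !₂[(p 1)⁻¹, -(p 0 / p 1 ^ 2)] p := by
  rw [hasGradientAt_iff_hasFDerivAt]
  have h0 := (EuclideanSpace.proj (𝕜 := ℝ) (0 : Fin 2)).hasFDerivAt (x := p)
  have h1 := (EuclideanSpace.proj (𝕜 := ℝ) (1 : Fin 2)).hasFDerivAt (x := p)
  have h := h0.mul ((hasDerivAt_inv hp).comp_hasFDerivAt p h1)
  refine (h.congr_fderiv ?_)
  ext v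
  simp [PiLp.inner_apply, Fin.sum_univ_two]
  ring

namespace IsStochasticIVModel

variable {Ω Ω' : Type*} [MeasurableSpace Ω] {μ : Measure Ω} {mΩ' : MeasurableSpace Ω'}
  {P' : Measure Ω'} {β₀ β₁ π₀ π₁ : ℝ} {Y D Z η ε : ℕ → Ω → ℝ}

theorem iIndepFun_comp (h : IsStochasticIVModel μ β₀ β₁ π₀ π₁ Y D Z η ε) {E : Type*}
    [MeasurableSpace E] {g : ℝ × ℝ × ℝ → E} (hg : Measurable g) :
    iIndepFun (fun i ω => g (Z i ω, η i ω, ε i ω)) μ :=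
  h.indep.comp (fun _ => g) fun _ => hg

theorem identDistrib_comp (h : IsStochasticIVModel μ β₀ β₁ π₀ π₁ Y D Z η ε) {E : Type*}
    [MeasurableSpace E] {g : ℝ × ℝ × ℝ → E} (hg : Measurable g) (i : ℕ) :
    IdentDistrib (fun ω => g (Z i ω, η i ω, ε i ω)) (fun ω => g (Z 0 ω, η 0 ω, ε 0 ω)) μ μ :=
  (h.ident i).comp hg

theorem aemeasurable_firstStage (h : IsStochasticIVModel μ β₀ β₁ π₀ π₁ Y D Z η ε) (i : ℕ) :
    AEMeasurable (D i) μ := by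
  rw [funext (h.firstStage i)]
  exact (((h.memLp_instrument i).aemeasurable.const_mul _).const_add _).add
    (h.memLp_firstStage i).aemeasurable

theorem aemeasurable_outcome (h : IsStochasticIVModel μ β₀ β₁ π₀ π₁ Y D Z η ε) (i : ℕ) :
    AEMeasurable (Y i) μ := by
  rw [funext (h.outcome i)]
  exact (((h.aemeasurable_firstStage i).const_mul _).const_add _).add
    (h.memLp_outcome i).aemeasurable

theorem sampleCov_outcome (h : IsStochasticIVModel μ β₀ β₁ π₀ π₁ Y D Z η ε) (n : ℕ) (ω : Ω) :
    sampleCov (fun i => Y i ω) (fun i => Z i ω) n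
      = β₁ * sampleCov (fun i => D i ω) (fun i => Z i ω) n
        + sampleCov (fun i => ε i ω) (fun i => Z i ω) n := by
  have := sampleCov_linear β₀ β₁ 1 (fun i => D i ω) (fun i => ε i ω) (fun i => Z i ω) n
  simpa [h.outcome] using this

variable [IsProbabilityMeasure μ] [IsProbabilityMeasure P']

/-- Asymptotic normality of the sample covariance of the instrument and a linear combination of
the variables of the model. -/
theorem tendstoInDistribution_sampleCov (h : IsStochasticIVModel μ β₀ β₁ π₀ π₁ Y D Z η ε)
    {G : Ω' → ℝ} (a b r s : ℝ) (hind : IndepFun (Z 0) (fun ω => r * η 0 ω + s * ε 0 ω) μ)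
    (hG : HasLaw G (gaussianReal 0 (b ^ 2 * (centralMoment (Z 0) 4 μ - 1)
      + Var[fun ω => r * η 0 ω + s * ε 0 ω; μ]).toNNReal) P') :
    TendstoInDistribution (fun (n : ℕ) ω => √(n : ℝ) *
      (sampleCov (fun i => a + b * Z i ω + (r * η i ω + s * ε i ω)) (fun i => Z i ω) n - b))
      atTop G (fun _ => μ) P' := by
  have hξ : MemLp (fun ω => r * η 0 ω + s * ε 0 ω) 2 μ :=
    ((h.memLp_firstStage 0).const_mul r).add ((h.memLp_outcome 0).const_mul s)
  have hZ := h.memLp_instrument 0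
  have hZ2 : MemLp (Z 0) 2 μ := hZ.mono_exponent (by norm_num)
  have hU : MemLp (fun ω => a + b * Z 0 ω + (r * η 0 ω + s * ε 0 ω)) 2 μ :=
    ((memLp_const a).add (hZ2.const_mul b)).add hξ
  have hg : Measurable fun p : ℝ × ℝ × ℝ => (a + b * p.1 + (r * p.2.1 + s * p.2.2), p.1) := by
    fun_prop
  -- Unit variance of the instrument and its independence of the noise make the centering constant
  -- exactly `b`.
  have hcov := covariance_of_linear (a := a) (b := b) rfl hZ2 hξ (h.variance_instrument 0)
  rw [hind.symm.covariance_eq_zero hξ hZ2, add_zero] at hcov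
  have hclt := tendstoInDistribution_sqrt_mul_sampleCov (P' := P') (G := G)
    (U := fun i ω => a + b * Z i ω + (r * η i ω + s * ε i ω)) (h.iIndepFun_comp hg)
    (h.identDistrib_comp hg) hU hZ2 (memLp_centered_mul_of_linear rfl hind hZ hξ)
    (by rwa [variance_centered_mul_of_linear rfl hind hZ hξ (h.variance_instrument 0)])
  rwa [hcov] at hclt

theorem ae_tendsto_sampleCov_firstStage (h : IsStochasticIVModel μ β₀ β₁ π₀ π₁ Y D Z η ε) :
    ∀ᵐ ω ∂μ, Tendsto (fun n => sampleCov (fun i => D i ω) (fun i => Z i ω) n) atTop (𝓝 π₁) := by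
  have hZ2 : MemLp (Z 0) 2 μ := (h.memLp_instrument 0).mono_exponent (by norm_num)
  have hg : Measurable fun p : ℝ × ℝ × ℝ => (π₀ + π₁ * p.1 + p.2.1, p.1) := by fun_prop
  have hD : MemLp (fun ω => π₀ + π₁ * Z 0 ω + η 0 ω) 2 μ :=
    ((memLp_const π₀).add (hZ2.const_mul π₁)).add (h.memLp_firstStage 0)
  have hcov := covariance_of_linear (a := π₀) (b := π₁) rfl hZ2 (h.memLp_firstStage 0)
    (h.variance_instrument 0)
  rw [(h.exogenous_firstStage 0).symm.covariance_eq_zero (h.memLp_firstStage 0) hZ2,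
    add_zero] at hcov
  have := ae_tendsto_sampleCov (U := fun i ω => π₀ + π₁ * Z i ω + η i ω) (h.iIndepFun_comp hg)
    (h.identDistrib_comp hg) hD hZ2
  rw [hcov] at this
  simpa only [h.firstStage] using this

end IsStochasticIVModel

/-- For arbitrary parameters the form can be negative; in the model nonnegativity comes from its
being a variance. -/
theorem posSemidef_asympCov {β₁ π₁ m₄ vη vε c : ℝ}
    (h : ∀ t : Fin 2 → ℝ, 0 ≤ t ⬝ᵥ asympCov β₁ π₁ m₄ vη vε c *ᵥ t) :
    (asympCov β₁ π₁ m₄ vη vε c).PosSemidef :=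
  Matrix.PosSemidef.of_dotProduct_mulVec_nonneg (isHermitian_asympCov _ _ _ _ _ _)
    fun t => by simpa using h t

theorem tendsto_div_sqrt {pen : ℕ → ℝ} (hpen : pen =o[atTop] fun n : ℕ => √(n : ℝ)) :
    Tendsto (fun n : ℕ => pen n / √(n : ℝ)) atTop (𝓝 0) :=
  hpen.tendsto_div_nhds_zero

theorem tendsto_div_natCast {pen : ℕ → ℝ} (hpen : pen =o[atTop] fun n : ℕ => √(n : ℝ)) :
    Tendsto (fun n : ℕ => pen n / (n : ℝ)) atTop (𝓝 0) := by
  have h := (tendsto_div_sqrt hpen).mul (tendsto_inv_atTop_zero.comp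
    (Real.tendsto_sqrt_atTop.comp tendsto_natCast_atTop_atTop))
  rw [zero_mul] at h
  refine h.congr fun n => ?_
  simp only [Function.comp_apply]
  rw [← div_eq_mul_inv, div_div, Real.mul_self_sqrt (Nat.cast_nonneg n)]

theorem sqrt_mul_div_natCast (p : ℝ) (n : ℕ) : √(n : ℝ) * (p / n) = p / √(n : ℝ) := by
  rw [mul_div_left_comm, Real.sqrt_div_self, div_eq_mul_inv]

theorem ridgeEstimator_sub_eq (pen : ℕ → ℝ) (y d z : ℕ → ℝ) (β₁ c : ℝ) (n : ℕ)
    (hc : sampleCov y z n = β₁ * sampleCov d z n + c) (h : sampleCov d z n + pen n / n ≠ 0) :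
    √(n : ℝ) * (ridgeEstimator pen y d z n - β₁)
      = (√(n : ℝ) * c - β₁ * (pen n / √(n : ℝ))) * (sampleCov d z n + pen n / n)⁻¹ := by
  rw [← sqrt_mul_div_natCast, ridgeEstimator_eq, hc]
  field_simp
  ring

/-- A deterministic null sequence does not affect convergence in distribution. -/
theorem tendstoInDistribution_add_of_tendsto_zero {Ω Ω' : Type*} {mΩ : MeasurableSpace Ω}
    {mΩ' : MeasurableSpace Ω'} {μ : Measure Ω} [IsProbabilityMeasure μ] {P' : Measure Ω'}
    [IsProbabilityMeasure P'] {X : ℕ → Ω → ℝ} {G : Ω' → ℝ} {c : ℕ → ℝ}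
    (hX : TendstoInDistribution X atTop G (fun _ => μ) P') (hc : Tendsto c atTop (𝓝 0)) :
    TendstoInDistribution (fun n ω => X n ω + c n) atTop G (fun _ => μ) P' := by
  have h := hX.add_of_tendstoInMeasure_const (Y := fun n _ => c n) (c := 0)
    (tendstoInMeasure_of_tendsto_ae (fun n => aestronglyMeasurable_const)
      (ae_of_all _ fun _ => hc)) fun n => aemeasurable_const
  simp only [add_zero] at h
  exact h

/-! ### Limit laws of the ridge estimator and of its numerator and denominator -/

namespace IsStochasticIVModel

variable {Ω : Type*} [MeasurableSpace Ω] {μ : Measure Ω} [IsProbabilityMeasure μ]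
  {β₀ β₁ π₀ π₁ : ℝ} {Y D Z η ε : ℕ → Ω → ℝ}

/-- Asymptotic normality of the ridge estimator. -/
theorem tendstoInDistribution_ridgeEstimator
    (h : IsStochasticIVModel μ β₀ β₁ π₀ π₁ Y D Z η ε) (hπ₁ : π₁ ≠ 0)
    {pen : ℕ → ℝ} (hpen : pen =o[atTop] fun n : ℕ => √(n : ℝ)) :
    TendstoInDistribution
      (fun (n : ℕ) ω => √(n : ℝ) *
        (ridgeEstimator pen (fun i => Y i ω) (fun i => D i ω) (fun i => Z i ω) n - β₁))
      atTop (id : ℝ → ℝ) (fun _ => μ) (gaussianReal 0 (Var[ε 0; μ] / π₁ ^ 2).toNNReal) := by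
  -- The limit of the numerator is realized as π₁ times the target variable, so that division by π₁
  -- returns `id` itself.
  have hG : HasLaw (fun x => π₁ * id x) (gaussianReal 0 Var[ε 0; μ].toNNReal)
      (gaussianReal 0 (Var[ε 0; μ] / π₁ ^ 2).toNNReal) := by
    convert! gaussianReal_const_mul HasLaw.id π₁ using 2
    · rw [mul_zero]
    · ext
      have := variance_nonneg (ε 0) μ
      simp only [NNReal.coe_mul, NNReal.coe_mk]
      rw [Real.coe_toNNReal _ this, Real.coe_toNNReal _ (by positivity)]
      field_simp
  -- These coefficients select U = ε: with b = 0 the fourth moment drops out, and only Z ⊥ ε is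
  -- required.
  have hclt := h.tendstoInDistribution_sampleCov (G := fun x => π₁ * id x) 0 0 0 1
    (by simpa using h.exogenous_outcome 0) (by simpa using hG)
  simp only [zero_mul, zero_add, one_mul, sub_zero] at hclt
  have hpen' : Tendsto (fun n : ℕ => -(β₁ * (pen n / √(n : ℝ)))) atTop (𝓝 0) := by
    simpa using ((tendsto_div_sqrt hpen).const_mul β₁).neg
  have hnum := tendstoInDistribution_add_of_tendsto_zero hclt hpen'
  have hDZ (n : ℕ) := aemeasurable_sampleCov h.aemeasurable_firstStage
    (fun i => (h.memLp_instrument i).aemeasurable) n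
  have hYZ (n : ℕ) := aemeasurable_sampleCov h.aemeasurable_outcome
    (fun i => (h.memLp_instrument i).aemeasurable) n
  have hden : ∀ᵐ ω ∂μ, Tendsto
      (fun n : ℕ => sampleCov (fun i => D i ω) (fun i => Z i ω) n + pen n / n) atTop (𝓝 π₁) := by
    filter_upwards [h.ae_tendsto_sampleCov_firstStage] with ω hω
    simpa using hω.add (tendsto_div_natCast hpen)
  have hdenm (n : ℕ) : AEMeasurable
      (fun ω => (sampleCov (fun i => D i ω) (fun i => Z i ω) n + pen n / n)⁻¹) μ :=
    ((hDZ n).add_const _).inv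
  have hinv : TendstoInMeasure μ
      (fun (n : ℕ) ω => (sampleCov (fun i => D i ω) (fun i => Z i ω) n + pen n / n)⁻¹) atTop
      (fun _ => π₁⁻¹) :=
    tendstoInMeasure_of_tendsto_ae (fun n => (hdenm n).aestronglyMeasurable)
      (hden.mono fun ω hω => hω.inv₀ hπ₁)
  have hprod := hnum.continuous_comp_prodMk_of_tendstoInMeasure_const
    (g := fun p : ℝ × ℝ => p.1 * p.2) (by fun_prop) hinv hdenm
  have hlim : (fun x : ℝ => π₁ * id x * π₁⁻¹) = id := by
    ext x
    simp only [id]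
    field_simp
  simp only [hlim] at hprod
  have hmeas (n : ℕ) : AEMeasurable (fun ω => √(n : ℝ) *
      (ridgeEstimator pen (fun i => Y i ω) (fun i => D i ω) (fun i => Z i ω) n - β₁)) μ := by
    simp only [ridgeEstimator_eq]
    exact (((hYZ n).div ((hDZ n).add_const _)).sub_const _).const_mul _
  refine tendstoInDistribution_of_tendstoInMeasure_sub _ _ hprod
    (tendstoInMeasure_of_tendsto_ae (fun n => ((hmeas n).sub
      (hprod.forall_aemeasurable n)).aestronglyMeasurable) ?_) hmeas
  -- The identity for the estimator fails where the denominator vanishes. Almost surely this stops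
  -- happening for large n, as the limit π₁ is nonzero, so the difference is eventually 0.
  filter_upwards [hden] with ω hω
  refine (tendsto_const_nhds (x := (0 : ℝ))).congr' ?_
  filter_upwards [hω.eventually_ne hπ₁] with n hn
  simp only [Pi.sub_apply]
  rw [ridgeEstimator_sub_eq pen _ _ _ β₁ _ n (h.sampleCov_outcome n ω) hn, ← sub_eq_add_neg,
    sub_self]

/-- The quadratic form of the asymptotic covariance matrix is the asymptotic variance of the
corresponding linear combination of sample covariances. -/
theorem dotProduct_asympCov_mulVec_eq_variance
    (h : IsStochasticIVModel μ β₀ β₁ π₀ π₁ Y D Z η ε) (m₄ : ℝ) (t : Fin 2 → ℝ) :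
    t ⬝ᵥ asympCov β₁ π₁ m₄ Var[η 0; μ] Var[ε 0; μ] cov[ε 0, η 0; μ] *ᵥ t
      = ((t 0 * β₁ + t 1) * π₁) ^ 2 * (m₄ - 1)
        + Var[fun ω => (t 0 * β₁ + t 1) * η 0 ω + t 0 * ε 0 ω; μ] := by
  have hvar := variance_add ((h.memLp_firstStage 0).const_mul (t 0 * β₁ + t 1))
    ((h.memLp_outcome 0).const_mul (t 0))
  rw [variance_const_mul, variance_const_mul, covariance_const_mul_left,
    covariance_const_mul_right, covariance_comm] at hvar
  rw [dotProduct_asympCov_mulVec]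
  congr 1
  refine Eq.trans ?_ hvar.symm
  ring

/-- Joint asymptotic normality of the numerator and the denominator of the ridge estimator. -/
theorem tendstoInDistribution_sampleCov_pair
    (h : IsStochasticIVModel μ β₀ β₁ π₀ π₁ Y D Z η ε)
    {pen : ℕ → ℝ} (hpen : pen =o[atTop] fun n : ℕ => √(n : ℝ))
    (hind : IndepFun (Z 0) (fun ω => (η 0 ω, ε 0 ω)) μ) :
    TendstoInDistribution
      (fun (n : ℕ) ω => √(n : ℝ) •
        (!₂[sampleCov (fun i => Y i ω) (fun i => Z i ω) n,
            sampleCov (fun i => D i ω) (fun i => Z i ω) n + pen n / n] - !₂[β₁ * π₁, π₁]))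
      atTop (id : EuclideanSpace ℝ (Fin 2) → EuclideanSpace ℝ (Fin 2)) (fun _ => μ)
      (multivariateGaussian 0 (asympCov β₁ π₁ (centralMoment (Z 0) 4 μ)
        Var[η 0; μ] Var[ε 0; μ] cov[ε 0, η 0; μ])) := by
  have hξ (r s : ℝ) : IndepFun (Z 0) (fun ω => r * η 0 ω + s * ε 0 ω) μ :=
    hind.comp (φ := id) (ψ := fun p : ℝ × ℝ => r * p.1 + s * p.2) measurable_id (by fun_prop)
  have hpsd : (asympCov β₁ π₁ (centralMoment (Z 0) 4 μ)
      Var[η 0; μ] Var[ε 0; μ] cov[ε 0, η 0; μ]).PosSemidef := by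
    refine posSemidef_asympCov fun t => ?_
    -- The form is the variance of the centered product of Z and b Z + ξ, hence nonnegative; the
    -- intercept plays no role.
    rw [h.dotProduct_asympCov_mulVec_eq_variance, ← variance_centered_mul_of_linear (a := 0) rfl
      (hξ _ _) (h.memLp_instrument 0) (((h.memLp_firstStage 0).const_mul _).add
        ((h.memLp_outcome 0).const_mul _)) (h.variance_instrument 0)]
    exact variance_nonneg _ _
  have hDZ (n : ℕ) := aemeasurable_sampleCov h.aemeasurable_firstStage
    (fun i => (h.memLp_instrument i).aemeasurable) n
  have hYZ (n : ℕ) := aemeasurable_sampleCov h.aemeasurable_outcome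
    (fun i => (h.memLp_instrument i).aemeasurable) n
  refine tendstoInDistribution_multivariateGaussian hpsd (fun t => ?_) fun n => ?_
  -- The coefficients are those of 1, Z, η, ε in the expansion of t₀Y + t₁D.
  · have hclt := h.tendstoInDistribution_sampleCov (G := id)
      (t 0 * (β₀ + β₁ * π₀) + t 1 * π₀) ((t 0 * β₁ + t 1) * π₁) (t 0 * β₁ + t 1) (t 0)
      (hξ _ _) HasLaw.id
    rw [h.dotProduct_asympCov_mulVec_eq_variance]
    have hpen' : Tendsto (fun n : ℕ => t 1 * (pen n / √(n : ℝ))) atTop (𝓝 0) := by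
      simpa using (tendsto_div_sqrt hpen).const_mul (t 1)
    refine (tendstoInDistribution_add_of_tendsto_zero hclt hpen').congr
      (fun n => ae_of_all _ fun ω => ?_) (ae_of_all _ fun _ => rfl)
    have hlin := sampleCov_linear 0 (t 0) (t 1) (fun i => Y i ω) (fun i => D i ω)
      (fun i => Z i ω) n
    have hU : (fun i => t 0 * (β₀ + β₁ * π₀) + t 1 * π₀ + (t 0 * β₁ + t 1) * π₁ * Z i ω
        + ((t 0 * β₁ + t 1) * η i ω + t 0 * ε i ω)) = fun i => 0 + t 0 * Y i ω + t 1 * D i ω := by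
      ext i
      rw [h.outcome, h.firstStage]
      ring
    simp only [hU, hlin, ← sqrt_mul_div_natCast]
    simp [PiLp.inner_apply, Fin.sum_univ_two]
    ring
  · have hpair : AEMeasurable (fun ω => !₂[sampleCov (fun i => Y i ω) (fun i => Z i ω) n,
        sampleCov (fun i => D i ω) (fun i => Z i ω) n + pen n / n]) μ := by
      refine (WithLp.measurable_toLp 2 _).comp_aemeasurable (aemeasurable_pi_lambda _ fun i => ?_)
      fin_cases i
      · exact hYZ n
      · exact (hDZ n).add_const _
    exact (hpair.sub_const _).const_smul √(n : ℝ)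

end IsStochasticIVModel

/-- The gradient is t = (1/π₁, −β₁/π₁), for which t₀β₁ + t₁ = 0; every term but t₀²·`vε` carries
this factor. -/
theorem dotProduct_asympCov_mulVec_gradient_ratio {β₁ π₁ : ℝ} (hπ₁ : π₁ ≠ 0) (m₄ vη vε c : ℝ) :
    (∇ ratio !₂[β₁ * π₁, π₁]).ofLp ⬝ᵥ
      (asympCov β₁ π₁ m₄ vη vε c *ᵥ (∇ ratio !₂[β₁ * π₁, π₁]).ofLp) = vε / π₁ ^ 2 := by
  rw [(hasGradientAt_ratio (p := !₂[β₁ * π₁, π₁]) (by simpa using hπ₁)).gradient,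
    dotProduct_asympCov_mulVec]
  simp
  field_simp
  ring

end RidgeIV

theorem mainTheorem3 {Ω : Type*} [MeasurableSpace Ω] (μ : Measure Ω) [IsProbabilityMeasure μ]
    (β₀ β₁ π₀ π₁ : ℝ) (Y D Z η ε : ℕ → Ω → ℝ)
    (hmodel : RidgeIV.IsStochasticIVModel μ β₀ β₁ π₀ π₁ Y D Z η ε)
    (hπ₁ : π₁ ≠ 0)
    (pen : ℕ → ℝ) (hpen : pen =o[atTop] fun n : ℕ => √(n : ℝ)) :
    -- asymptotic normality of the ridge estimator, with variance `σ_ε² / π₁²`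
    TendstoInDistribution
      (fun (n : ℕ) ω => √(n : ℝ) *
        (RidgeIV.ridgeEstimator pen (fun i => Y i ω) (fun i => D i ω) (fun i => Z i ω) n - β₁))
      atTop (id : ℝ → ℝ) (fun _ => μ) (gaussianReal 0 (Var[ε 0; μ] / π₁ ^ 2).toNNReal) ∧
    -- joint asymptotic normality of the numerator and the denominator
    ((∀ i, IndepFun (Z i) (fun ω => (η i ω, ε i ω)) μ) →
      TendstoInDistribution
        (fun (n : ℕ) ω => √(n : ℝ) •
          (!₂[RidgeIV.sampleCov (fun i => Y i ω) (fun i => Z i ω) n,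
              RidgeIV.sampleCov (fun i => D i ω) (fun i => Z i ω) n + pen n / n]
            - !₂[β₁ * π₁, π₁]))
        atTop (id : EuclideanSpace ℝ (Fin 2) → EuclideanSpace ℝ (Fin 2)) (fun _ => μ)
        (multivariateGaussian 0 (RidgeIV.asympCov β₁ π₁ (centralMoment (Z 0) 4 μ)
          Var[η 0; μ] Var[ε 0; μ] cov[ε 0, η 0; μ]))) ∧
    -- the delta-method variance of the ratio does not depend on the fourth moment
    DifferentiableAt ℝ RidgeIV.ratio !₂[β₁ * π₁, π₁] ∧
    (∇ RidgeIV.ratio !₂[β₁ * π₁, π₁]).ofLp ⬝ᵥ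
        (RidgeIV.asympCov β₁ π₁ (centralMoment (Z 0) 4 μ)
          Var[η 0; μ] Var[ε 0; μ] cov[ε 0, η 0; μ] *ᵥ
            (∇ RidgeIV.ratio !₂[β₁ * π₁, π₁]).ofLp)
      = Var[ε 0; μ] / π₁ ^ 2 := by
  refine ⟨hmodel.tendstoInDistribution_ridgeEstimator hπ₁ hpen,
    fun hind => hmodel.tendstoInDistribution_sampleCov_pair hpen (hind 0),
    (RidgeIV.hasGradientAt_ratio (by simpa using hπ₁)).hasFDerivAt.differentiableAt,
    RidgeIV.dotProduct_asympCov_mulVec_gradient_ratio hπ₁ _ _ _ _⟩
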